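/- Let $d\ge 2$ and let $\mathbb T_d$ be the infinite tree in which every vertex has $d+1$ neighbours, with a distinguished root; write $u<v$ if $u\ne v$ and $u$ lies on the path from the root to $v$, and let $\operatorname{dist}$ be the graph distance. Let $(X_v)$ be independent random variables indexed by the vertices, with $\mathbb P(X_v=k)=(1-p)p^k$ for $k=0,1,2,\dots$, where $p\in(0,1)$. At time $0$ only the root is informed; at each step, each newly informed vertex $v$ informs all non-informed vertices $v'>v$ with $\operatorname{dist}(v,v')\le X_v$. The model percolates if infinitely many vertices are eventually informed, and $p_c^{\mathbf{cp}}(d)$ denotes the infimum of the $p\in(0,1)$ for which this has positive probability. Then, for every $d\ge2$, $p_c^{\mathbf{cp}}(d)$ is the unique solution $q\in(0,1)$ of $$\sum_{k\ge1}(dq)^k\prod_{i=1}^{k-1}(1-q^i)=1 .$$ More explicitly, $0.266667\le p_c^{\mathbf{cp}}(2)\le 0.277206$, and for every $d\ge3$ $$\frac{1}{2d-\frac14}\le p_c^{\mathbf{cp}}(d)\le\frac{(7d-1)\left(1-\sqrt{1-\frac{14}{(7d-1)^2}}\right)}{2}.$$ -/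

import Mathlib

noncomputable section

namespace ConePercolation

open MeasureTheory ProbabilityTheory

/-- Vertices of the rooted homogeneous tree in which every vertex has `d + 1` neighbours, coded by
words: the empty word is the root, and the children of a vertex `w` are the words `w ++ [a]`. The
first letter takes `d + 1` values and every later letter takes `d` values, so the root has `d + 1`
children and every other vertex has one parent and `d` children. -/
abbrev Vertex (d : ℕ) : Type :=
  {w : List (Fin (d + 1)) // ∀ a ∈ w.tail, (a : ℕ) < d}

/-- The root of the tree. -/
def root (d : ℕ) : Vertex d := ⟨[], by simp⟩

/-- The distance of a vertex to the root. -/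
def depth {d : ℕ} (v : Vertex d) : ℕ := v.1.length

/-- `u < v`: the vertex `u` is different from `v` and lies on the path from the root to `v`. -/
def Below {d : ℕ} (u v : Vertex d) : Prop := u ≠ v ∧ u.1 <+: v.1

/-- The vertices `v > u` at distance at most `r` from `u`. The path from `u` to such a `v` goes
away from the root, so the distance is the difference of the depths. -/
def cone {d : ℕ} (u : Vertex d) (r : ℕ) : Set (Vertex d) :=
  {v | Below u v ∧ depth v - depth u ≤ r}

/-- The set of vertices informed at time `n` or earlier when the radii are `X`: at time `0` only
the root is informed, and at each step each informed vertex `u` informs all vertices `v > u` at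
distance at most `X u`. (Vertices informed before the last step inform nobody new.) -/
def informedBy {d : ℕ} (X : Vertex d → ℕ) : ℕ → Set (Vertex d)
  | 0 => {root d}
  | n + 1 => informedBy X n ∪ ⋃ u ∈ informedBy X n, cone u (X u)

/-- The model percolates: infinitely many vertices are eventually informed. -/
def Percolates {d : ℕ} (X : Vertex d → ℕ) : Prop := (⋃ n, informedBy X n).Infinite

/-- The law of the radii: independent, with `P(X_v = k) = (1 - p) p ^ k` for `k = 0, 1, 2, …`. -/
def radiiLaw (d : ℕ) (p : unitInterval) : Measure (Vertex d → ℕ) :=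
  Measure.infinitePi fun _ => geometricMeasure (unitInterval.symm p)

/-- The probability that the model percolates. -/
def percolationProb (d : ℕ) (p : unitInterval) : ℝ :=
  (radiiLaw d p).real {X | Percolates X}

/-- The critical parameter: the infimum of the `p ∈ (0, 1)` for which the model percolates with
positive probability. -/
def criticalParameter (d : ℕ) : ℝ :=
  sInf {p : ℝ | ∃ hp : p ∈ Set.Ioo (0 : ℝ) 1,
    0 < percolationProb d ⟨p, Set.Ioo_subset_Icc_self hp⟩}

/-- `q` solves `∑_{k ≥ 1} c (d q) ^ k ∏_{i = 1}^{k - 1} (1 - c q ^ i) = 1`; the sum is indexed by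
`j = k - 1 ≥ 0`. -/
def SolvesLocalization (c : ℝ) (d : ℕ) (q : ℝ) : Prop :=
  HasSum (fun j : ℕ => c * (d * q) ^ (j + 1) * ∏ i ∈ Finset.Icc 1 j, (1 - c * q ^ i)) 1

end ConePercolation

end

/-!
A vertex is eventually informed iff the cones of its ancestors jump over every edge of its path
from the root, so it is informed with a probability `u n` depending only on its depth `n`.
Conditioning on the last ancestor whose cone reaches the vertex turns `n ↦ u n` into a renewal
sequence, and for geometric radii the weights of `u n * d ^ n` are exactly the summands of the
localization equation at `p`.

If these weights sum to less than `1`, the expected number of informed vertices is finite. If they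
sum to more than `1`, then `u N * d ^ N > 1` for some `N`; the lineages made of blocks of `N`
generations, each of which uses only its own radii, then form a supercritical branching process
whose offspring counts have a bounded second moment, and such a process survives.

Write `F y q` for `localizationSum y q`, so that the weights sum to `F (d * p) p`. Since `x - x ^ i`
is increasing on `[0, 1 / 2]`, this sum is strictly increasing in `p` there. The functional equation
`(1 - y) * F y q = y - y * F (y * q) q` makes `F y q ≤ 1` equivalent to
`y * (2 - F (y * q) q) ≤ 1`, where elementary bounds on `F` are already sharp enough for the
explicit estimates of the critical parameter.
-/

namespace ConePercolation

open Filter MeasureTheory ProbabilityTheory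
open Finset.HasAntidiagonal (antidiagonal mem_antidiagonal)
open scoped ENNReal Topology

section Measure

/-- The law of independent random variables of law `ν` indexed by `ι`. -/
noncomputable abbrev iidLaw {E : Type*} [MeasurableSpace E] (ι : Type*) (ν : Measure E) :
    Measure (ι → E) :=
  Measure.infinitePi fun _ => ν

lemma measurePreserving_comp_iidLaw {ι κ E : Type*} [MeasurableSpace E] (ν : Measure E)
    [IsProbabilityMeasure ν] {f : ι → κ} (hf : f.Injective) :
    MeasurePreserving (fun (x : κ → E) i => x (f i)) (iidLaw κ ν) (iidLaw ι ν) where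
  measurable := by fun_prop
  map_eq := Measure.map_infinitePi_infinitePi_of_inj (P := fun _ => ν) hf

lemma indep_cylinderEvents_infinitePi {ι : Type*} {E : ι → Type*} [∀ i, MeasurableSpace (E i)]
    (P : ∀ i, Measure (E i)) [∀ i, IsProbabilityMeasure (P i)] {S T : Set ι} (h : Disjoint S T) :
    Indep (cylinderEvents S) (cylinderEvents T) (Measure.infinitePi P) :=
  indep_iSup_of_disjoint (fun i => (measurable_pi_apply i).comap_le)
    (iIndepFun_infinitePi (X := fun _ x => x) fun _ => measurable_id) h

lemma measureReal_inter_of_indep {Ω : Type*} {m₁ m₂ m : MeasurableSpace Ω} {μ : Measure Ω}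
    (h : Indep m₁ m₂ μ) {A B : Set Ω} (hA : MeasurableSet[m₁] A) (hB : MeasurableSet[m₂] B) :
    μ.real (A ∩ B) = μ.real A * μ.real B := by
  simp only [measureReal_def, (Indep_iff _ _ _).1 h A B hA hB, ENNReal.toReal_mul]

/-- Bonferroni's inequality, except that the pairs are counted twice. -/
lemma sum_measureReal_le_measureReal_biUnion_add {Ω κ : Type*} [MeasurableSpace Ω]
    (μ : Measure Ω) [IsFiniteMeasure μ] {C : κ → Set Ω} (hC : ∀ i, MeasurableSet (C i))
    (s : Finset κ) :
    ∑ i ∈ s, μ.real (C i) ≤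
      μ.real (⋃ i ∈ s, C i) + ∑ ij ∈ s.offDiag, μ.real (C ij.1 ∩ C ij.2) := by
  classical
  induction s using Finset.induction_on with
  | empty => simp
  | insert a s ha ih =>
    have hunion : μ.real (⋃ i ∈ insert a s, C i) + μ.real (C a ∩ ⋃ i ∈ s, C i) =
        μ.real (C a) + μ.real (⋃ i ∈ s, C i) := by
      rw [Finset.set_biUnion_insert]
      exact measureReal_union_add_inter (s.measurableSet_biUnion fun i _ => hC i)
        (measure_ne_top _ _) (measure_ne_top _ _)
    have hinter : μ.real (C a ∩ ⋃ i ∈ s, C i) ≤ ∑ i ∈ s, μ.real (C a ∩ C i) := by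
      rw [Set.inter_iUnion₂]
      exact measureReal_biUnion_finset_le s _
    have hpairs : ∑ ij ∈ s.offDiag, μ.real (C ij.1 ∩ C ij.2) + ∑ i ∈ s, μ.real (C a ∩ C i) ≤
        ∑ ij ∈ (insert a s).offDiag, μ.real (C ij.1 ∩ C ij.2) := by
      have hproduct : ∑ i ∈ s, μ.real (C a ∩ C i) =
          ∑ ij ∈ {a} ×ˢ s, μ.real (C ij.1 ∩ C ij.2) := by
        simp
      rw [hproduct, ← Finset.sum_union (by grind [Finset.disjoint_left])]
      refine Finset.sum_le_sum_of_subset_of_nonneg ?_ fun _ _ _ => measureReal_nonneg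
      rw [Finset.offDiag_insert ha]
      exact Finset.subset_union_left
    rw [Finset.sum_insert ha]
    linarith

lemma tsum_comp_eq_tsum_encard_mul {α β : Type*} (f : α → β) (g : β → ℝ≥0∞) :
    ∑' a, g (f a) = ∑' b, (f ⁻¹' {b}).encard * g b := by
  rw [← ENNReal.tsum_fiberwise _ f]
  refine tsum_congr fun b => ?_
  rw [← ENNReal.tsum_set_const]
  exact tsum_congr fun a => congrArg g a.2

end Measure

/-- The sequence `u` is the renewal sequence of the weights `a`, where `a j` is the weight of a
renewal gap of length `j + 1`. -/
structure IsRenewal (a u : ℕ → ℝ) : Prop where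
  zero : u 0 = 1
  succ (n : ℕ) : u (n + 1) = ∑ ij ∈ antidiagonal n, u ij.1 * a ij.2

namespace IsRenewal

variable {a u : ℕ → ℝ}

lemma scale (h : IsRenewal a u) (s : ℝ) :
    IsRenewal (fun j => a j * s ^ (j + 1)) (fun n => u n * s ^ n) where
  zero := by simp [h.zero]
  succ n := by
    rw [h.succ, Finset.sum_mul]
    refine Finset.sum_congr rfl fun ij hij => ?_
    rw [← mem_antidiagonal.1 hij]
    ring

lemma nonneg (h : IsRenewal a u) (ha : ∀ j, 0 ≤ a j) (n : ℕ) : 0 ≤ u n := by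
  induction n using Nat.strong_induction_on with
  | _ n ih =>
    rcases n with _ | n
    · simp [h.zero]
    · rw [h.succ]
      exact Finset.sum_nonneg fun ij hij => mul_nonneg
        (ih _ (Nat.lt_succ_of_le (Finset.HasAntidiagonal.antidiagonal.fst_le hij))) (ha _)

lemma sum_range_succ_le (h : IsRenewal a u) (ha : ∀ j, 0 ≤ a j) (M : ℕ) :
    ∑ n ∈ Finset.range (M + 1), u n ≤
      1 + (∑ n ∈ Finset.range M, u n) * ∑ j ∈ Finset.range M, a j := by
  have hmaps : ∀ n ∈ Finset.range M, antidiagonal n =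
      {ij ∈ Finset.range M ×ˢ Finset.range M | ij.1 + ij.2 = n} := by
    intro n hn
    ext ij
    simp only [Finset.mem_range, mem_antidiagonal, Finset.mem_filter,
      Finset.mem_product] at hn ⊢
    omega
  rw [Finset.sum_range_succ', h.zero, add_comm, Finset.sum_mul_sum, ← Finset.sum_product']
  gcongr
  simp_rw [h.succ]
  rw [Finset.sum_congr rfl fun n hn => by rw [hmaps n hn]]
  exact Finset.sum_fiberwise_le_sum_of_sum_fiber_nonneg fun n _ =>
    Finset.sum_nonneg fun ij _ => mul_nonneg (h.nonneg ha _) (ha _)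

lemma summable (h : IsRenewal a u) (ha : ∀ j, 0 ≤ a j) (hs : Summable a) (hlt : ∑' j, a j < 1) :
    Summable u := by
  refine summable_of_sum_range_le (c := 1 / (1 - ∑' j, a j)) (h.nonneg ha) fun M => ?_
  have hpartial : 0 ≤ ∑ n ∈ Finset.range M, u n := Finset.sum_nonneg fun n _ => h.nonneg ha n
  have hrenewal : ∑ n ∈ Finset.range M, u n ≤ 1 + (∑ n ∈ Finset.range M, u n) * ∑' j, a j :=
    calc ∑ n ∈ Finset.range M, u n ≤ ∑ n ∈ Finset.range (M + 1), u n := by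
          rw [Finset.sum_range_succ]
          exact le_add_of_nonneg_right (h.nonneg ha M)
      _ ≤ 1 + (∑ n ∈ Finset.range M, u n) * ∑ j ∈ Finset.range M, a j := h.sum_range_succ_le ha M
      _ ≤ 1 + (∑ n ∈ Finset.range M, u n) * ∑' j, a j := by
          gcongr
          exact hs.sum_le_tsum _ fun j _ => ha j
  rw [le_div_iff₀ (sub_pos.2 hlt)]
  linarith

lemma summable_weights (h : IsRenewal a u) (ha : ∀ j, 0 ≤ a j) (hu : Summable u) :
    Summable a := by
  refine .of_nonneg_of_le ha (fun j => ?_) ((summable_nat_add_iff 1).2 hu)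
  have hmem : (0, j) ∈ antidiagonal j := mem_antidiagonal.2 (zero_add j)
  have hterm := Finset.single_le_sum (f := fun ij : ℕ × ℕ => u ij.1 * a ij.2)
    (fun ij _ => mul_nonneg (h.nonneg ha _) (ha _)) hmem
  simpa [h.succ, h.zero] using hterm

lemma tsum_weights_lt_one (h : IsRenewal a u) (ha : ∀ j, 0 ≤ a j) (hu : Summable u) :
    ∑' j, a j < 1 := by
  have hs := h.summable_weights ha hu
  have hrenewal : ∑' n, u n = 1 + (∑' n, u n) * ∑' j, a j := by
    rw [hu.tsum_mul_tsum_eq_tsum_sum_antidiagonal hs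
      (hu.mul_of_nonneg hs (h.nonneg ha) ha)]
    simpa only [h.zero, h.succ] using hu.tsum_eq_zero_add
  have hpos : 0 < ∑' n, u n := by
    refine hu.tsum_pos (h.nonneg ha) 0 ?_
    simp [h.zero]
  nlinarith

/-- If `u ≤ 1`, then `u n * s ^ n` is summable for every `s < 1`, so the weights `a j * s ^ (j + 1)`
have sum less than `1`; now let `s` tend to `1`. -/
lemma sum_weights_le_one (h : IsRenewal a u) (ha : ∀ j, 0 ≤ a j) (hu : ∀ n, u n ≤ 1) (K : ℕ) :
    ∑ j ∈ Finset.range K, a j ≤ 1 := by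
  have hscaled : ∀ s ∈ Set.Ioo (0 : ℝ) 1, ∑ j ∈ Finset.range K, a j * s ^ (j + 1) ≤ 1 := by
    intro s hs
    have has : ∀ j, 0 ≤ a j * s ^ (j + 1) := fun j => mul_nonneg (ha j) (pow_nonneg hs.1.le _)
    have hus : Summable fun n => u n * s ^ n :=
      .of_nonneg_of_le (fun n => mul_nonneg (h.nonneg ha n) (pow_nonneg hs.1.le n))
        (fun n => mul_le_of_le_one_left (pow_nonneg hs.1.le n) (hu n))
        (summable_geometric_of_lt_one hs.1.le hs.2)
    exact (((h.scale s).summable_weights has hus).sum_le_tsum _ fun j _ => has j).trans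
      ((h.scale s).tsum_weights_lt_one has hus).le
  have hlim : Tendsto (fun s : ℝ => ∑ j ∈ Finset.range K, a j * s ^ (j + 1)) (𝓝[<] 1)
      (𝓝 (∑ j ∈ Finset.range K, a j)) := by
    refine Tendsto.mono_left ?_ nhdsWithin_le_nhds
    have hcont : Continuous fun s : ℝ => ∑ j ∈ Finset.range K, a j * s ^ (j + 1) := by fun_prop
    simpa using hcont.tendsto 1
  exact le_of_tendsto hlim (by filter_upwards [Ioo_mem_nhdsLT one_pos] using hscaled)

end IsRenewal

section Coverage

/-- With radius `x j` at site `j` of the half line, every edge `{i, i + 1}` with `i < n` is jumped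
over, so the information started at `0` arrives at `n`. -/
def Covered (x : ℕ → ℕ) (n : ℕ) : Prop := ∀ i < n, ∃ j ≤ i, i < j + x j

/-- The sites before `n` whose radius reaches `n`. -/
def reachers (x : ℕ → ℕ) (n : ℕ) : Set ℕ := {m | m < n ∧ n ≤ m + x m}

lemma Covered.mono {x : ℕ → ℕ} {m n : ℕ} (h : Covered x n) (hmn : m ≤ n) : Covered x m :=
  fun i hi => h i (hi.trans_le hmn)

lemma Covered.of_le_add {x : ℕ → ℕ} {m n : ℕ} (h : Covered x m) (hn : n ≤ m + x m) :
    Covered x n := by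
  intro i hi
  obtain him | hmi := lt_or_ge i m
  · exact h i him
  · exact ⟨m, hmi, hi.trans_le hn⟩

lemma covered_congr {x y : ℕ → ℕ} {n : ℕ} (h : ∀ j < n, x j = y j) :
    Covered x n ↔ Covered y n := by
  refine forall₂_congr fun i hi => exists_congr fun j => and_congr_right fun hj => ?_
  rw [h j (hj.trans_lt hi)]

lemma covered_succ_iff {x : ℕ → ℕ} {n : ℕ} :
    Covered x (n + 1) ↔ ∃ m, Covered x m ∧ IsGreatest (reachers x (n + 1)) m := by
  constructor
  · intro h
    obtain ⟨j, hj, hreach⟩ := h n n.lt_succ_self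
    obtain ⟨m, hm⟩ := BddAbove.exists_isGreatest_of_nonempty (S := reachers x (n + 1))
      ⟨n + 1, fun k hk => hk.1.le⟩ ⟨j, Nat.lt_succ_of_le hj, hreach⟩
    exact ⟨m, h.mono hm.1.1.le, hm⟩
  · rintro ⟨m, hcov, hm, -⟩
    exact hcov.of_le_add hm.2

lemma ofPred_isGreatest_reachers (m j : ℕ) :
    {x | IsGreatest (reachers x (m + j + 1)) m} = Set.pi (Finset.Ico m (m + j + 1))
      fun i => if i = m then Set.Ici (j + 1) else Set.Iio (m + j + 1 - i) := by
  ext x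
  simp only [IsGreatest, reachers, upperBounds, Set.mem_ofPred_eq, Set.mem_pi, Finset.coe_Ico,
    Set.mem_Ico]
  constructor
  · rintro ⟨⟨-, hm⟩, hmax⟩ i hi
    split_ifs with him
    · subst him
      exact Set.mem_Ici.2 (by omega)
    · have := @hmax i
      exact Set.mem_Iio.2 (by omega)
  · intro h
    have hm := h m (by omega)
    rw [if_pos rfl, Set.mem_Ici] at hm
    refine ⟨by omega, fun i hi => ?_⟩
    by_contra! hmi
    have hlt := h i (by omega)
    rw [if_neg hmi.ne', Set.mem_Iio] at hlt
    omega

lemma measurableSet_cylinderEvents_covered_comp {ι : Type*} {S : Set ι} {f : ℕ → ι} {n : ℕ}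
    (hf : ∀ j < n, f j ∈ S) :
    MeasurableSet[cylinderEvents S] {x : ι → ℕ | Covered (fun j => x (f j)) n} := by
  have hcoord (j : ℕ) (hj : j < n) (t : Set ℕ) :
      MeasurableSet[cylinderEvents S] ((fun x : ι → ℕ => x (f j)) ⁻¹' t) :=
    measurable_cylinderEvent_apply (hf j hj) .of_discrete
  simp only [Covered, ← exists_prop, Set.ofPred_forall, Set.ofPred_exists]
  exact .iInter fun i => .iInter fun hi => .iUnion fun j => .iUnion fun hj =>
    hcoord j (hj.trans_lt hi) {k | i < j + k}

lemma measurableSet_covered_comp {ι : Type*} (f : ℕ → ι) (n : ℕ) :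
    MeasurableSet {x : ι → ℕ | Covered (fun j => x (f j)) n} :=
  cylinderEvents_le_pi (Δ := Set.univ) _
    (measurableSet_cylinderEvents_covered_comp fun j _ => Set.mem_univ (f j))

lemma measurableSet_isGreatest_reachers (m j : ℕ) :
    MeasurableSet[cylinderEvents (Set.Ici m)]
      {x : ℕ → ℕ | IsGreatest (reachers x (m + j + 1)) m} := by
  rw [ofPred_isGreatest_reachers, Set.pi_def]
  exact .biInter (Finset.countable_toSet _) fun i hi =>
    measurable_cylinderEvent_apply (Finset.mem_Ico.1 hi).1 .of_discrete

variable (ν : Measure ℕ)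

/-- The probability that site `n` of the half line is covered when the radii are independent of
law `ν`. -/
noncomputable def coverProb (n : ℕ) : ℝ := (iidLaw ℕ ν).real {x | Covered x n}

lemma coverProb_nonneg (n : ℕ) : 0 ≤ coverProb ν n := measureReal_nonneg

/-- The probability that the last site whose radius reaches `n`, where `j + 1 ≤ n`, is
`n - (j + 1)`. -/
noncomputable def reachWeight (j : ℕ) : ℝ :=
  ν.real (Set.Ici (j + 1)) * ∏ i ∈ Finset.range j, ν.real (Set.Iio (i + 1))

lemma reachWeight_nonneg (j : ℕ) : 0 ≤ reachWeight ν j :=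
  mul_nonneg measureReal_nonneg (Finset.prod_nonneg fun _ _ => measureReal_nonneg)

variable [IsProbabilityMeasure ν]

lemma measureReal_isGreatest_reachers (m j : ℕ) :
    (iidLaw ℕ ν).real {x | IsGreatest (reachers x (m + j + 1)) m} = reachWeight ν j := by
  rw [ofPred_isGreatest_reachers, measureReal_def,
    Measure.infinitePi_pi _ fun _ _ => .of_discrete, ENNReal.toReal_prod,
    Finset.prod_Ico_eq_prod_range, add_assoc, Nat.add_sub_cancel_left, Finset.prod_range_succ',
    reachWeight, ← Finset.prod_range_reflect, mul_comm]
  congr 1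
  · simp [measureReal_def]
  · refine Finset.prod_congr rfl fun i hi => ?_
    have hgap : m + (j + 1) - (m + (j - 1 - i + 1)) = i + 1 := by
      have := Finset.mem_range.1 hi
      omega
    simp [measureReal_def, hgap]

/-- Conditioning on the last site `m` whose radius reaches `n + 1`: whether `m` is covered depends
only on the radii before `m`, and the choice of `m` only on the radii from `m` on. -/
lemma isRenewal_coverProb : IsRenewal (reachWeight ν) (coverProb ν) where
  zero := by simp [coverProb, Covered]
  succ n := by
    set C : ℕ × ℕ → Set (ℕ → ℕ) := fun ij =>
      {x | Covered x ij.1} ∩ {x | IsGreatest (reachers x (ij.1 + ij.2 + 1)) ij.1}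
    have hcov (m : ℕ) : MeasurableSet[cylinderEvents (Set.Iio m)] {x : ℕ → ℕ | Covered x m} :=
      measurableSet_cylinderEvents_covered_comp fun j hj => hj
    have hsplit : {x | Covered x (n + 1)} = ⋃ ij ∈ antidiagonal n, C ij := by
      ext x
      simp only [C, Set.mem_ofPred_eq, covered_succ_iff, Set.mem_iUnion, exists_prop, Prod.exists,
        mem_antidiagonal, Set.mem_inter_iff]
      constructor
      · rintro ⟨m, hm, hgreatest⟩
        obtain ⟨j, rfl⟩ := Nat.exists_eq_add_of_le (Nat.le_of_lt_succ hgreatest.1.1)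
        exact ⟨m, j, rfl, hm, hgreatest⟩
      · rintro ⟨m, j, rfl, h⟩
        exact ⟨m, h⟩
    have hdisj : (antidiagonal n : Set (ℕ × ℕ)).PairwiseDisjoint C := by
      refine fun ij hij kl hkl hne => Set.disjoint_left.2 fun x hx hx' => hne ?_
      rw [Finset.mem_coe, mem_antidiagonal] at hij hkl
      have hfst : ij.1 = kl.1 := hx.2.unique (by rw [hij, ← hkl]; exact hx'.2)
      exact Prod.ext hfst (by omega)
    rw [coverProb, hsplit, measureReal_biUnion_finset hdisj fun ij _ =>
      (cylinderEvents_le_pi _ (hcov _)).inter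
        (cylinderEvents_le_pi _ (measurableSet_isGreatest_reachers _ _))]
    refine Finset.sum_congr rfl fun ij _ => ?_
    rw [measureReal_inter_of_indep
      (indep_cylinderEvents_infinitePi _ (Set.Iio_disjoint_Ici le_rfl)) (hcov _)
      (measurableSet_isGreatest_reachers _ _), measureReal_isGreatest_reachers, coverProb]

/-- Only the first `n` radii matter, so `f` may be completed to an injection into `ι ⊕ ℕ`. -/
lemma measureReal_covered_comp {ι : Type*} {f : ℕ → ι} {n : ℕ} (hf : Set.InjOn f (Set.Iio n)) :
    (iidLaw ι ν).real {x | Covered (fun j => x (f j)) n} = coverProb ν n := by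
  set F : ℕ → ι ⊕ ℕ := fun j => if j < n then .inl (f j) else .inr j
  have hF : F.Injective := by
    intro i j hij
    simp only [F] at hij
    split_ifs at hij with hi hj
    exacts [hf hi hj (Sum.inl_injective hij), Sum.inr_injective hij]
  rw [coverProb, ← (measurePreserving_comp_iidLaw ν hF).measureReal_preimage
      (s := {x | Covered x n}) (measurableSet_covered_comp id n).nullMeasurableSet,
    ← (measurePreserving_comp_iidLaw ν Sum.inl_injective).measureReal_preimage
      (measurableSet_covered_comp f n).nullMeasurableSet]
  congr 1
  ext z
  refine covered_congr fun j hj => ?_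
  simp [F, hj]

end Coverage

section Lineage

variable {α : Type*}

/-- In the regular tree of words over `α` with radii `X`, the information started at the empty
word arrives at `w`. -/
def CoveredWord (X : List α → ℕ) (w : List α) : Prop :=
  Covered (fun j => X (w.take j)) w.length

lemma CoveredWord.append {X : List α → ℕ} {u w : List α} (hu : CoveredWord X u)
    (hw : CoveredWord (fun l => X (u ++ l)) w) : CoveredWord X (u ++ w) := by
  intro i hi
  rw [List.length_append] at hi
  obtain hiu | hui := lt_or_ge i u.length
  · obtain ⟨j, hj, hreach⟩ := hu i hiu
    exact ⟨j, hj, by simpa only [List.take_append_of_le_length (hj.trans hiu.le)] using hreach⟩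
  · obtain ⟨k, rfl⟩ := Nat.exists_eq_add_of_le hui
    obtain ⟨j, hj, hreach⟩ := hw k (by omega)
    refine ⟨u.length + j, by omega, ?_⟩
    simp only [List.take_length_add_append] at hreach ⊢
    omega

/-- There are words `u₁, …, uₙ` of length `N` such that, for every `i < n`, the information
started at `u₁ ⋯ uᵢ` arrives at `u₁ ⋯ uᵢ₊₁`. Forgetting in each step what was received from
before `u₁ ⋯ uᵢ` makes the steps independent. -/
def HasLineage (N : ℕ) : ℕ → (List α → ℕ) → Prop
  | 0, _ => True
  | n + 1, X => ∃ u : Fin N → α,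
      CoveredWord X (List.ofFn u) ∧ HasLineage N n fun l => X (List.ofFn u ++ l)

lemma HasLineage.of_succ {N n : ℕ} {X : List α → ℕ} (h : HasLineage N (n + 1) X) :
    HasLineage N n X := by
  induction n generalizing X with
  | zero => trivial
  | succ n ih =>
    obtain ⟨u, hu, hrest⟩ := h
    exact ⟨u, hu, ih hrest⟩

lemma HasLineage.exists_coveredWord {N n : ℕ} {X : List α → ℕ} (h : HasLineage N n X) :
    ∃ w, w.length = n * N ∧ CoveredWord X w := by
  induction n generalizing X with
  | zero => exact ⟨[], by simp, fun i hi => absurd hi i.not_lt_zero⟩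
  | succ n ih =>
    obtain ⟨u, hu, hrest⟩ := h
    obtain ⟨w, hlength, hw⟩ := ih hrest
    exact ⟨List.ofFn u ++ w, by simp [hlength]; ring, hu.append hw⟩

lemma measurableSet_cylinderEvents_coveredWord (w : List α) :
    MeasurableSet[cylinderEvents {l | l.length < w.length}]
      {X : List α → ℕ | CoveredWord X w} :=
  measurableSet_cylinderEvents_covered_comp fun j hj => (List.length_take_le j w).trans_lt hj

lemma measurableSet_coveredWord (w : List α) : MeasurableSet {X : List α → ℕ | CoveredWord X w} :=
  measurableSet_covered_comp _ _

lemma measurableSet_hasLineage [Finite α] (N n : ℕ) :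
    MeasurableSet {X : List α → ℕ | HasLineage N n X} := by
  induction n with
  | zero => exact .univ
  | succ n ih =>
    simp only [HasLineage, Set.ofPred_exists]
    refine .iUnion fun u => (measurableSet_coveredWord _).inter ?_
    have hshift : Measurable fun (X : List α → ℕ) l => X (List.ofFn u ++ l) := by fun_prop
    exact hshift ih

lemma measurableSet_cylinderEvents_hasLineage_append [Finite α] (N n : ℕ) (u : List α) :
    MeasurableSet[cylinderEvents (Set.range (u ++ ·))]
      {X : List α → ℕ | HasLineage N n fun l => X (u ++ l)} := by
  have hshift : Measurable[cylinderEvents (Set.range (u ++ ·))]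
      fun (X : List α → ℕ) l => X (u ++ l) :=
    @measurable_pi_lambda _ _ _ (cylinderEvents _) _ _ fun l =>
      measurable_cylinderEvent_apply (Set.mem_range_self l)
  exact hshift (measurableSet_hasLineage N n)

variable (α) in
/-- The probability of a lineage of `n` blocks of length `N` when the radii are independent of
law `ν`. -/
noncomputable def lineageProb (ν : Measure ℕ) (N n : ℕ) : ℝ :=
  (iidLaw (List α) ν).real {X | HasLineage N n X}

variable (ν : Measure ℕ) [IsProbabilityMeasure ν]

lemma lineageProb_succ_le (N n : ℕ) : lineageProb α ν N (n + 1) ≤ lineageProb α ν N n :=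
  measureReal_mono fun _ h => h.of_succ

lemma measureReal_coveredWord (w : List α) :
    (iidLaw (List α) ν).real {X | CoveredWord X w} = coverProb ν w.length := by
  refine measureReal_covered_comp ν fun i hi j hj hij => ?_
  have hlength := congrArg List.length hij
  rwa [List.length_take_of_le (le_of_lt hi), List.length_take_of_le (le_of_lt hj)] at hlength

section

variable [Finite α]

lemma measureReal_hasLineage_append (N n : ℕ) (u : List α) :
    (iidLaw (List α) ν).real {X | HasLineage N n fun l => X (u ++ l)} = lineageProb α ν N n :=
  (measurePreserving_comp_iidLaw ν (List.append_right_injective u)).measureReal_preimage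
    (measurableSet_hasLineage N n).nullMeasurableSet

lemma measureReal_coveredWord_inter_hasLineage (N n : ℕ) (u : List α) :
    (iidLaw (List α) ν).real
        ({X | CoveredWord X u} ∩ {X | HasLineage N n fun l => X (u ++ l)}) =
      coverProb ν u.length * lineageProb α ν N n := by
  have hdisj : Disjoint {l | l.length < u.length} (Set.range (u ++ ·)) := by
    rw [Set.disjoint_right]
    rintro _ ⟨l, rfl⟩
    simp
  rw [measureReal_inter_of_indep (indep_cylinderEvents_infinitePi _ hdisj)
    (measurableSet_cylinderEvents_coveredWord u)
    (measurableSet_cylinderEvents_hasLineage_append N n u),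
    measureReal_hasLineage_append, measureReal_coveredWord]

lemma measureReal_hasLineage_append_inter (N n : ℕ) {u v : List α} (hlength : u.length = v.length)
    (hne : u ≠ v) :
    (iidLaw (List α) ν).real
        ({X | HasLineage N n fun l => X (u ++ l)} ∩ {X | HasLineage N n fun l => X (v ++ l)}) =
      lineageProb α ν N n ^ 2 := by
  have hdisj : Disjoint (Set.range (u ++ ·)) (Set.range (v ++ ·)) := by
    rw [Set.disjoint_left]
    rintro _ ⟨l, rfl⟩ ⟨k, hk⟩
    exact hne (List.append_inj_left hk.symm hlength)
  rw [measureReal_inter_of_indep (indep_cylinderEvents_infinitePi _ hdisj)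
    (measurableSet_cylinderEvents_hasLineage_append N n u)
    (measurableSet_cylinderEvents_hasLineage_append N n v),
    measureReal_hasLineage_append, measureReal_hasLineage_append, sq]

end

variable [Fintype α]

lemma card_mul_coverProb_mul_lineageProb_le (N n : ℕ) :
    Fintype.card α ^ N * coverProb ν N * lineageProb α ν N n ≤
      lineageProb α ν N (n + 1) + (Fintype.card α ^ N) ^ 2 * lineageProb α ν N n ^ 2 := by
  classical
  set C : (Fin N → α) → Set (List α → ℕ) := fun u => {X | CoveredWord X (List.ofFn u)} ∩
    {X | HasLineage N n fun l => X (List.ofFn u ++ l)}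
  have hC (u : Fin N → α) : MeasurableSet (C u) := (measurableSet_coveredWord _).inter
    (cylinderEvents_le_pi _ (measurableSet_cylinderEvents_hasLineage_append N n _))
  have hunion : {X | HasLineage N (n + 1) X} = ⋃ u ∈ Finset.univ, C u := by
    ext X
    simp [C, HasLineage]
  have hpairs : ∑ uv ∈ Finset.univ.offDiag, (iidLaw (List α) ν).real (C uv.1 ∩ C uv.2) ≤
      (Fintype.card α ^ N) ^ 2 * lineageProb α ν N n ^ 2 := by
    refine (Finset.sum_le_card_nsmul _ _ (lineageProb α ν N n ^ 2) fun uv huv => ?_).trans ?_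
    · rw [← measureReal_hasLineage_append_inter ν N n (by simp)
        (List.ofFn_injective.ne (Finset.mem_offDiag.1 huv).2.2)]
      exact measureReal_mono (Set.inter_subset_inter Set.inter_subset_right
        Set.inter_subset_right)
    · rw [nsmul_eq_mul, Finset.offDiag_card]
      gcongr
      exact_mod_cast (Nat.sub_le _ _).trans_eq (by simp [sq])
  calc Fintype.card α ^ N * coverProb ν N * lineageProb α ν N n
      = ∑ u, (iidLaw (List α) ν).real (C u) := by
        simp [C, measureReal_coveredWord_inter_hasLineage, mul_assoc]
    _ ≤ (iidLaw (List α) ν).real (⋃ u ∈ Finset.univ, C u) +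
          ∑ uv ∈ Finset.univ.offDiag, (iidLaw (List α) ν).real (C uv.1 ∩ C uv.2) :=
        sum_measureReal_le_measureReal_biUnion_add _ hC _
    _ ≤ lineageProb α ν N (n + 1) + (Fintype.card α ^ N) ^ 2 * lineageProb α ν N n ^ 2 := by
        rw [← hunion]
        exact add_le_add_right hpairs _

lemma lineageProb_pos {N : ℕ} (h : 1 < Fintype.card α ^ N * coverProb ν N) (n : ℕ) :
    0 < lineageProb α ν N n := by
  have hcover : 0 < coverProb ν N :=
    pos_of_mul_pos_right (one_pos.trans h) (by positivity)
  have hword : 0 < Fintype.card (Fin N → α) := by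
    have hcard : (0 : ℝ) < Fintype.card α ^ N := pos_of_mul_pos_left (one_pos.trans h) hcover.le
    rw [Fintype.card_fun, Fintype.card_fin]
    exact_mod_cast hcard
  obtain ⟨u⟩ := Fintype.card_pos_iff.1 hword
  induction n with
  | zero => simp [lineageProb, HasLineage]
  | succ n ih =>
    have hchild := measureReal_coveredWord_inter_hasLineage ν N n (List.ofFn u)
    rw [List.length_ofFn] at hchild
    exact (mul_pos hcover ih).trans_le (hchild.symm.trans_le (measureReal_mono fun X hX => ⟨u, hX⟩))

/-- The lineage probabilities `θₙ` decrease and satisfy `θₙ₊₁ ≥ m θₙ - M² θₙ²`, so `θₙ` cannot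
drop below `(m - 1) / M²`. -/
lemma measureReal_forall_hasLineage_pos {N : ℕ} (h : 1 < Fintype.card α ^ N * coverProb ν N) :
    0 < (iidLaw (List α) ν).real {X | ∀ n, HasLineage N n X} := by
  set M : ℝ := Fintype.card α ^ N
  have hM : 0 < M := by
    refine lt_of_le_of_ne (by positivity) fun hzero => ?_
    simp [← hzero] at h
    linarith
  have hbound (n : ℕ) : (M * coverProb ν N - 1) / M ^ 2 ≤ lineageProb α ν N n := by
    have hpos := lineageProb_pos ν h n
    have hstep := (card_mul_coverProb_mul_lineageProb_le ν N n (α := α)).trans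
      (add_le_add_left (lineageProb_succ_le ν N n) _)
    rw [div_le_iff₀ (by positivity)]
    refine le_of_mul_le_mul_right ?_ hpos
    linarith
  have hlim : Tendsto (lineageProb α ν N) atTop
      (𝓝 ((iidLaw (List α) ν).real {X | ∀ n, HasLineage N n X})) := by
    rw [Set.ofPred_forall]
    exact (ENNReal.tendsto_toReal (measure_ne_top _ _)).comp (tendsto_measure_iInter_atTop
      (fun n => (measurableSet_hasLineage N n).nullMeasurableSet)
      (antitone_nat_of_succ_le fun n X h => h.of_succ) ⟨0, measure_ne_top _ _⟩)
  exact (div_pos (sub_pos.2 h) (by positivity)).trans_le (ge_of_tendsto' hlim hbound)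

end Lineage

section Tree

variable {d : ℕ}

/-- The vertex at depth `j` on the path from the root to `v`; it is `v` itself if
`depth v ≤ j`. -/
def ancestor (v : Vertex d) (j : ℕ) : Vertex d :=
  ⟨v.1.take j, fun a ha => v.2 a ((List.take_sublist j v.1).tail.subset ha)⟩

@[simp]
lemma depth_ancestor (v : Vertex d) (j : ℕ) : depth (ancestor v j) = min j (depth v) :=
  List.length_take

lemma eq_root_of_depth_eq_zero {v : Vertex d} (h : depth v = 0) : v = root d :=
  Subtype.ext (List.length_eq_zero_iff.1 h)

lemma ancestor_ancestor (v : Vertex d) {i j : ℕ} (h : i ≤ j) :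
    ancestor (ancestor v j) i = ancestor v i := by
  simp [ancestor, List.take_take, min_eq_left h]

lemma injOn_ancestor (v : Vertex d) : Set.InjOn (ancestor v) (Set.Iio (depth v)) := by
  intro i hi j hj hij
  have hdepth := congrArg depth hij
  simp only [depth_ancestor] at hdepth
  rwa [min_eq_left (le_of_lt hi), min_eq_left (le_of_lt hj)] at hdepth

lemma mem_cone_iff {u v : Vertex d} {r : ℕ} :
    v ∈ cone u r ↔ ∃ m < depth v, u = ancestor v m ∧ depth v ≤ m + r := by
  constructor
  · rintro ⟨⟨hne, hpre⟩, hdepth⟩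
    have hlt : depth u < depth v :=
      lt_of_le_of_ne hpre.length_le fun h => hne (Subtype.ext (hpre.eq_of_length h))
    exact ⟨depth u, hlt, Subtype.ext (List.prefix_iff_eq_take.1 hpre), by omega⟩
  · rintro ⟨m, hm, rfl, hdepth⟩
    have hdepth_ancestor : depth (ancestor v m) = m := by simp [hm.le]
    refine ⟨⟨fun h => ?_, List.take_prefix m v.1⟩, by omega⟩
    rw [h] at hdepth_ancestor
    omega

lemma covered_ancestor_iff {X : Vertex d → ℕ} {v : Vertex d} {m : ℕ} (hm : m ≤ depth v) :
    Covered (fun j => X (ancestor (ancestor v m) j)) (depth (ancestor v m)) ↔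
      Covered (fun j => X (ancestor v j)) m := by
  rw [depth_ancestor, min_eq_left hm]
  exact covered_congr fun j hj => by rw [ancestor_ancestor v hj.le]

lemma covered_of_mem_informedBy {X : Vertex d → ℕ} {n : ℕ} {v : Vertex d}
    (h : v ∈ informedBy X n) : Covered (fun j => X (ancestor v j)) (depth v) := by
  induction n generalizing v with
  | zero =>
    obtain rfl : v = root d := h
    exact fun i hi => absurd hi i.not_lt_zero
  | succ n ih =>
    simp only [informedBy, Set.mem_union, Set.mem_iUnion, exists_prop] at h
    obtain h | ⟨u, hu, huv⟩ := h
    · exact ih h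
    · obtain ⟨m, hm, rfl, hdepth⟩ := mem_cone_iff.1 huv
      exact ((covered_ancestor_iff hm.le).1 (ih hu)).of_le_add hdepth

lemma mem_iUnion_informedBy_iff {X : Vertex d → ℕ} {v : Vertex d} :
    v ∈ ⋃ n, informedBy X n ↔ Covered (fun j => X (ancestor v j)) (depth v) := by
  refine ⟨fun h => covered_of_mem_informedBy (Set.mem_iUnion.1 h).choose_spec, fun h => ?_⟩
  induction hn : depth v using Nat.strong_induction_on generalizing v with
  | _ n ih =>
    subst hn
    obtain hzero | hpos := (depth v).eq_zero_or_pos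
    · exact Set.mem_iUnion.2 ⟨0, eq_root_of_depth_eq_zero hzero⟩
    · rw [← Nat.sub_add_cancel hpos, covered_succ_iff, Nat.sub_add_cancel hpos] at h
      obtain ⟨m, hcov, ⟨hm, hreach⟩, -⟩ := h
      obtain ⟨k, hk⟩ := Set.mem_iUnion.1
        (ih (depth (ancestor v m)) (by simp [hm]) ((covered_ancestor_iff hm.le).2 hcov) rfl)
      exact Set.mem_iUnion.2 ⟨k + 1, .inr <| Set.mem_biUnion hk <|
        mem_cone_iff.2 ⟨m, hm, rfl, hreach⟩⟩

/-- The vertex of the tree given by a word in which every letter takes `d` values. -/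
def ofWord (w : List (Fin d)) : Vertex d :=
  ⟨w.map Fin.castSucc, fun a ha => by
    obtain ⟨b, -, rfl⟩ := List.mem_map.1 (List.mem_of_mem_tail ha)
    exact b.isLt⟩

lemma ofWord_injective : (ofWord (d := d)).Injective := fun _ _ h =>
  List.map_injective_iff.2 (Fin.castSucc_injective d) (congrArg Subtype.val h)

@[simp]
lemma depth_ofWord (w : List (Fin d)) : depth (ofWord w) = w.length :=
  List.length_map _

lemma ancestor_ofWord (w : List (Fin d)) (j : ℕ) : ancestor (ofWord w) j = ofWord (w.take j) :=
  Subtype.ext List.map_take.symm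

lemma exists_eq_cons_ofWord_of_depth_eq_succ {n : ℕ} {v : Vertex d} (h : depth v = n + 1) :
    ∃ (a : Fin (d + 1)) (u : Fin n → Fin d), v.1 = a :: (ofWord (List.ofFn u)).1 := by
  obtain ⟨_ | ⟨a, w⟩, hw⟩ := v
  · simp [depth] at h
  · obtain rfl : w.length = n := Nat.succ_injective h
    refine ⟨a, fun i => ⟨w.get i, hw _ (List.get_mem w i)⟩, ?_⟩
    simp only [ofWord, List.map_ofFn, List.cons.injEq, true_and]
    exact (List.ofFn_get w).symm

lemma encard_depth_preimage_le (hd : 0 < d) (n : ℕ) :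
    (depth ⁻¹' {n} : Set (Vertex d)).encard ≤ (d + 1) * d ^ n := by
  rw [← Subtype.val_injective.encard_image]
  cases n with
  | zero =>
    have hsub : Subtype.val '' (depth ⁻¹' {0} : Set (Vertex d)) ⊆ {[]} := by
      rintro _ ⟨v, hv, rfl⟩
      exact congrArg Subtype.val (eq_root_of_depth_eq_zero hv)
    refine (Set.encard_le_encard hsub).trans ?_
    simp
  | succ n =>
    have hsub : Subtype.val '' (depth ⁻¹' {n + 1} : Set (Vertex d)) ⊆
        (fun p : Fin (d + 1) × (Fin n → Fin d) => p.1 :: (ofWord (List.ofFn p.2)).1) ''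
          Set.univ := by
      rintro _ ⟨v, hv, rfl⟩
      obtain ⟨a, u, h⟩ := exists_eq_cons_ofWord_of_depth_eq_succ hv
      exact ⟨(a, u), trivial, h.symm⟩
    calc _ ≤ _ := Set.encard_le_encard hsub
      _ ≤ _ := Set.encard_image_le _ _
      _ = (((d + 1) * d ^ n : ℕ) : ℕ∞) := by simp [Set.encard_univ, ENat.card_eq_coe_fintype_card]
      _ ≤ (((d + 1) * d ^ (n + 1) : ℕ) : ℕ∞) := by gcongr; omega
      _ = _ := by push_cast; rfl

end Tree

section Percolation

variable {d : ℕ}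

lemma percolates_of_forall_hasLineage {X : Vertex d → ℕ} {N : ℕ} (hN : 0 < N)
    (h : ∀ n, HasLineage N n fun w => X (ofWord w)) : Percolates X := by
  refine Set.Infinite.of_image depth (Set.infinite_of_forall_exists_gt fun n => ?_)
  obtain ⟨w, hlength, hw⟩ := (h (n + 1)).exists_coveredWord
  refine ⟨w.length, ⟨ofWord w, mem_iUnion_informedBy_iff.2 ?_, depth_ofWord w⟩, ?_⟩
  · simpa only [ancestor_ofWord, depth_ofWord, CoveredWord] using hw
  · rw [hlength]
    nlinarith

variable (ν : Measure ℕ) [IsProbabilityMeasure ν]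

lemma measureReal_mem_iUnion_informedBy (v : Vertex d) :
    (iidLaw (Vertex d) ν).real {X | v ∈ ⋃ n, informedBy X n} = coverProb ν (depth v) := by
  simp only [mem_iUnion_informedBy_iff]
  exact measureReal_covered_comp ν (injOn_ancestor v)

lemma measureReal_percolates_eq_zero (hd : 0 < d)
    (h : Summable fun n => coverProb ν n * (d : ℝ) ^ n) :
    (iidLaw (Vertex d) ν).real {X | Percolates X} = 0 := by
  have hvertex (v : Vertex d) : iidLaw (Vertex d) ν {X | v ∈ ⋃ n, informedBy X n} =
      ENNReal.ofReal (coverProb ν (depth v)) := by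
    rw [← measureReal_mem_iUnion_informedBy, ofReal_measureReal]
  have hlevel (n : ℕ) : ((depth ⁻¹' {n} : Set (Vertex d)).encard : ℝ≥0∞) *
      ENNReal.ofReal (coverProb ν n) ≤ (d + 1) * ENNReal.ofReal (coverProb ν n * (d : ℝ) ^ n) := by
    have hcard : ((depth ⁻¹' {n} : Set (Vertex d)).encard : ℝ≥0∞) ≤ (d + 1) * d ^ n := by
      exact_mod_cast ENat.toENNReal_le.2 (encard_depth_preimage_le hd n)
    refine (mul_le_mul_left hcard _).trans_eq ?_
    rw [ENNReal.ofReal_mul (coverProb_nonneg ν n), ENNReal.ofReal_pow d.cast_nonneg,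
      ENNReal.ofReal_natCast]
    ring
  have hsum : ∑' v : Vertex d, iidLaw (Vertex d) ν {X | v ∈ ⋃ n, informedBy X n} ≠ ∞ := by
    simp only [hvertex]
    rw [tsum_comp_eq_tsum_encard_mul depth fun n => ENNReal.ofReal (coverProb ν n)]
    refine ne_top_of_le_ne_top ?_ (ENNReal.tsum_le_tsum hlevel)
    rw [ENNReal.tsum_mul_left]
    exact ENNReal.mul_ne_top (by simp) h.tsum_ofReal_ne_top
  rw [measureReal_eq_zero_iff]
  exact measure_mono_null (fun X hX hfin => hX hfin) (ae_finite_setOfPred_mem hsum)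

lemma measureReal_percolates_pos {N : ℕ} (h : 1 < (d : ℝ) ^ N * coverProb ν N) :
    0 < (iidLaw (Vertex d) ν).real {X | Percolates X} := by
  have hN : 0 < N := by
    refine Nat.pos_of_ne_zero fun hzero => ?_
    simp [hzero, (isRenewal_coverProb ν).zero] at h
  have hlineage := measureReal_forall_hasLineage_pos (α := Fin d) ν (N := N) (by simpa using h)
  have hmeas : MeasurableSet {X : List (Fin d) → ℕ | ∀ n, HasLineage N n X} := by
    rw [Set.ofPred_forall]
    exact .iInter (measurableSet_hasLineage N)
  rw [← (measurePreserving_comp_iidLaw ν ofWord_injective).measureReal_preimage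
    hmeas.nullMeasurableSet] at hlineage
  exact hlineage.trans_le (measureReal_mono fun X hX => percolates_of_forall_hasLineage hN hX)

lemma measureReal_percolates_eq_zero_of_tsum_lt_one (hd : 0 < d)
    (hs : Summable fun j => reachWeight ν j * (d : ℝ) ^ (j + 1))
    (hlt : ∑' j, reachWeight ν j * (d : ℝ) ^ (j + 1) < 1) :
    (iidLaw (Vertex d) ν).real {X | Percolates X} = 0 :=
  measureReal_percolates_eq_zero ν hd <| ((isRenewal_coverProb ν).scale d).summable
    (fun j => mul_nonneg (reachWeight_nonneg ν j) (by positivity)) hs hlt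

lemma measureReal_percolates_pos_of_one_lt_sum {K : ℕ}
    (h : 1 < ∑ j ∈ Finset.range K, reachWeight ν j * (d : ℝ) ^ (j + 1)) :
    0 < (iidLaw (Vertex d) ν).real {X | Percolates X} := by
  by_contra! hzero
  refine h.not_ge (((isRenewal_coverProb ν).scale d).sum_weights_le_one
    (fun j => mul_nonneg (reachWeight_nonneg ν j) (by positivity)) (fun N => ?_) K)
  by_contra! hN
  exact hzero.not_gt (measureReal_percolates_pos ν (mul_comm (coverProb ν N) _ ▸ hN))

end Percolation

section Localization

/-- The summand `y ^ (j + 1) ∏_{i = 1}^j (1 - q ^ i)` of the localization series. The localization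
equation of the tree is the diagonal case `y = d * q`; keeping `y` independent of `q` makes room for
the functional equation relating `y` to `y * q`. -/
def localizationTerm (y q : ℝ) (j : ℕ) : ℝ :=
  y ^ (j + 1) * ∏ i ∈ Finset.range j, (1 - q ^ (i + 1))

/-- The localization series `∑_{k ≥ 1} y ^ k ∏_{i = 1}^{k - 1} (1 - q ^ i)`, with the junk value `0`
where it diverges. -/
noncomputable def localizationSum (y q : ℝ) : ℝ := ∑' j, localizationTerm y q j

variable {y p q : ℝ}

@[simp] lemma localizationTerm_zero (y q : ℝ) : localizationTerm y q 0 = y := by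
  simp [localizationTerm]

lemma localizationTerm_succ (y q : ℝ) (j : ℕ) :
    localizationTerm y q (j + 1) = y * localizationTerm y q j -
      y * localizationTerm (y * q) q j := by
  simp only [localizationTerm, Finset.prod_range_succ, mul_pow]
  ring

lemma localizationTerm_nonneg (hy : 0 ≤ y) (hq : q ∈ Set.Icc 0 1) (j : ℕ) :
    0 ≤ localizationTerm y q j :=
  mul_nonneg (pow_nonneg hy _) <| Finset.prod_nonneg fun _ _ =>
    sub_nonneg.2 (pow_le_one₀ hq.1 hq.2)

lemma localizationTerm_le_pow (hy : 0 ≤ y) (hq : q ∈ Set.Icc 0 1) (j : ℕ) :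
    localizationTerm y q j ≤ y ^ (j + 1) :=
  mul_le_of_le_one_right (pow_nonneg hy _) <| Finset.prod_le_one
    (fun _ _ => sub_nonneg.2 (pow_le_one₀ hq.1 hq.2))
    fun _ _ => sub_le_self _ (pow_nonneg hq.1 _)

lemma solvesLocalization_one_iff {d : ℕ} :
    SolvesLocalization 1 d q ↔ HasSum (localizationTerm (d * q) q) 1 := by
  unfold SolvesLocalization localizationTerm
  simp only [one_mul, Finset.range_eq_Ico, Finset.prod_Ico_add' (fun i => 1 - q ^ i), zero_add,
    Finset.Ico_add_one_right_eq_Icc]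

lemma hasSum_pow_succ (hy : y ∈ Set.Ico 0 1) : HasSum (fun j => y ^ (j + 1)) (y / (1 - y)) := by
  simpa only [pow_succ', div_eq_mul_inv] using
    (hasSum_geometric_of_lt_one hy.1 hy.2).mul_left y

lemma summable_localizationTerm (hy : y ∈ Set.Ico 0 1) (hq : q ∈ Set.Icc 0 1) :
    Summable (localizationTerm y q) :=
  .of_nonneg_of_le (localizationTerm_nonneg hy.1 hq) (localizationTerm_le_pow hy.1 hq)
    (hasSum_pow_succ hy).summable

lemma le_localizationSum (hy : y ∈ Set.Ico 0 1) (hq : q ∈ Set.Icc 0 1) :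
    y ≤ localizationSum y q :=
  (localizationTerm_zero y q).symm.trans_le <|
    (summable_localizationTerm hy hq).le_tsum 0 fun j _ => localizationTerm_nonneg hy.1 hq j

lemma localizationSum_le_div (hy : y ∈ Set.Ico 0 1) (hq : q ∈ Set.Icc 0 1) :
    localizationSum y q ≤ y / (1 - y) :=
  hasSum_le (localizationTerm_le_pow hy.1 hq) (summable_localizationTerm hy hq).hasSum
    (hasSum_pow_succ hy)

lemma mul_mem_Ico (hy : y ∈ Set.Ico 0 1) (hq : q ∈ Set.Icc 0 1) : y * q ∈ Set.Ico (0 : ℝ) 1 :=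
  ⟨mul_nonneg hy.1 hq.1, (mul_le_of_le_one_right hy.1 hq.2).trans_lt hy.2⟩

lemma one_sub_mul_localizationSum (hy : y ∈ Set.Ico 0 1) (hq : q ∈ Set.Icc 0 1) :
    (1 - y) * localizationSum y q = y - y * localizationSum (y * q) q := by
  have hs := summable_localizationTerm hy hq
  have hs' := summable_localizationTerm (mul_mem_Ico hy hq) hq
  have hshift := hs.tsum_eq_zero_add
  simp only [localizationTerm_zero, localizationTerm_succ] at hshift
  rw [(hs.mul_left y).tsum_sub (hs'.mul_left y), tsum_mul_left, tsum_mul_left] at hshift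
  simp only [localizationSum]
  linarith

lemma localizationSum_le_one_iff (hy : y ∈ Set.Ico 0 1) (hq : q ∈ Set.Icc 0 1) :
    localizationSum y q ≤ 1 ↔ y * (2 - localizationSum (y * q) q) ≤ 1 := by
  have hpos : 0 < 1 - y := sub_pos.2 hy.2
  rw [← mul_le_iff_le_one_right hpos, one_sub_mul_localizationSum hy hq]
  constructor <;> intro h <;> linarith

lemma one_le_localizationSum_iff (hy : y ∈ Set.Ico 0 1) (hq : q ∈ Set.Icc 0 1) :
    1 ≤ localizationSum y q ↔ 1 ≤ y * (2 - localizationSum (y * q) q) := by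
  have hpos : 0 < 1 - y := sub_pos.2 hy.2
  rw [← le_mul_iff_one_le_right hpos, one_sub_mul_localizationSum hy hq]
  constructor <;> intro h <;> linarith

lemma localizationSum_le_one (hy : y ∈ Set.Ico 0 1) (hq : q ∈ Set.Icc 0 1)
    (h : y * (2 - y * q) ≤ 1) : localizationSum y q ≤ 1 := by
  refine (localizationSum_le_one_iff hy hq).2 (h.trans' ?_)
  have := le_localizationSum (mul_mem_Ico hy hq) hq
  have := hy.1
  gcongr

lemma one_le_localizationSum (hy : y ∈ Set.Ico 0 1) (hq : q ∈ Set.Icc 0 1)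
    (h : 1 ≤ y * (2 - y * q / (1 - y * q))) : 1 ≤ localizationSum y q := by
  refine (one_le_localizationSum_iff hy hq).2 (h.trans ?_)
  have := localizationSum_le_div (mul_mem_Ico hy hq) hq
  have := hy.1
  gcongr

lemma monotoneOn_id_sub_pow_succ (n : ℕ) :
    MonotoneOn (fun x : ℝ => x - x ^ (n + 1)) (Set.Icc 0 (1 / 2)) := by
  intro p hp q hq hpq
  induction n with
  | zero => simp
  | succ n ih =>
    have hpow : p ^ (n + 1) ≤ 1 / 2 :=
      (pow_le_of_le_one hp.1 (by linarith [hp.2]) n.succ_ne_zero).trans hp.2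
    have hqle : q ≤ 1 / 2 := hq.2
    have hmul : q * (q ^ (n + 1) - p ^ (n + 1)) ≤ 1 / 2 * (q - p) := by
      have := hp.1
      refine mul_le_mul hqle (by linarith) (sub_nonneg.2 (by gcongr)) (by norm_num)
    have hmul' : p ^ (n + 1) * (q - p) ≤ 1 / 2 * (q - p) := by gcongr
    linear_combination hmul + hmul'

/-- Each of the `j` factors `x` of `x ^ (j + 1)` pairs with a factor `1 - x ^ i` into the monotone
`x - x ^ (i + 1)`; the factor `x` left over gives the strict monotonicity. -/
lemma mul_localizationTerm_le {c : ℝ} (hc : 0 ≤ c) (hp : 0 ≤ p) (hpq : p ≤ q) (hq : q ≤ 1 / 2)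
    (j : ℕ) : q * localizationTerm (c * p) p j ≤ p * localizationTerm (c * q) q j := by
  have hfactor (x : ℝ) : localizationTerm (c * x) x j =
      c ^ (j + 1) * x * ∏ i ∈ Finset.range j, (x - x ^ (i + 1 + 1)) := by
    have hprod : ∏ i ∈ Finset.range j, (x - x ^ (i + 1 + 1)) =
        x ^ j * ∏ i ∈ Finset.range j, (1 - x ^ (i + 1)) := by
      simp only [pow_succ' x (_ + 1), ← mul_one_sub, Finset.prod_mul_distrib, Finset.prod_const,
        Finset.card_range]
    rw [hprod, localizationTerm]
    ring
  have hprod : ∏ i ∈ Finset.range j, (p - p ^ (i + 1 + 1)) ≤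
      ∏ i ∈ Finset.range j, (q - q ^ (i + 1 + 1)) := by
    refine Finset.prod_le_prod (fun i _ => sub_nonneg.2 ?_) fun i _ =>
      monotoneOn_id_sub_pow_succ (i + 1) ⟨hp, hpq.trans hq⟩ ⟨hp.trans hpq, hq⟩ hpq
    exact pow_le_of_le_one hp (by linarith) (i + 1).succ_ne_zero
  have hq0 : 0 ≤ q := hp.trans hpq
  calc q * localizationTerm (c * p) p j
      = c ^ (j + 1) * p * q * ∏ i ∈ Finset.range j, (p - p ^ (i + 1 + 1)) := by
        rw [hfactor]; ring
    _ ≤ c ^ (j + 1) * p * q * ∏ i ∈ Finset.range j, (q - q ^ (i + 1 + 1)) := by gcongr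
    _ = p * localizationTerm (c * q) q j := by rw [hfactor]; ring

lemma mul_localizationSum_le {c : ℝ} (hc : 0 ≤ c) (hp : 0 ≤ p) (hpq : p ≤ q) (hq : q ≤ 1 / 2)
    (hcq : c * q < 1) : q * localizationSum (c * p) p ≤ p * localizationSum (c * q) q := by
  have hsum {x : ℝ} (hx : 0 ≤ x) (hxq : x ≤ q) : Summable (localizationTerm (c * x) x) :=
    summable_localizationTerm ⟨by positivity, hcq.trans_le' (by gcongr)⟩ ⟨hx, by linarith⟩
  simp only [localizationSum, ← tsum_mul_left]
  exact Summable.tsum_le_tsum (mul_localizationTerm_le hc hp hpq hq)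
    ((hsum hp hpq).mul_left q) ((hsum (hp.trans hpq) le_rfl).mul_left p)

lemma lt_one_of_hasSum_localizationTerm (hy : 0 < y) (hq : q ∈ Set.Ico 0 1)
    (h : HasSum (localizationTerm y q) 1) : y < 1 := by
  have hle := sum_le_hasSum (Finset.range 2)
    (fun j _ => localizationTerm_nonneg hy.le (Set.Ico_subset_Icc_self hq) j) h
  have hpos : 0 < y ^ 2 * (1 - q) := mul_pos (pow_pos hy 2) (sub_pos.2 hq.2)
  simp only [localizationTerm, Finset.sum_range_succ, Finset.range_one, Finset.sum_singleton,
    Finset.range_zero, Finset.prod_empty, Finset.prod_singleton, zero_add, pow_one, mul_one,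
    one_add_one_eq_two] at hle
  linarith

lemma continuousOn_localizationSum_mul_self {c b : ℝ} (hc : 0 ≤ c) (hb : b ∈ Set.Icc 0 1)
    (hcb : c * b < 1) : ContinuousOn (fun q => localizationSum (c * q) q) (Set.Icc 0 b) := by
  refine continuousOn_tsum (fun j => ?_)
    (hasSum_pow_succ ⟨mul_nonneg hc hb.1, hcb⟩).summable fun j q hq => ?_
  · unfold localizationTerm
    fun_prop
  · have hq0 := hq.1
    have hqb := hq.2
    have hcq : 0 ≤ c * q := by positivity
    have hq' : q ∈ Set.Icc 0 1 := ⟨hq0, hqb.trans hb.2⟩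
    rw [Real.norm_of_nonneg (localizationTerm_nonneg hcq hq' j)]
    refine (localizationTerm_le_pow hcq hq' j).trans ?_
    gcongr

lemma exists_hasSum_localizationTerm {c : ℝ} (hc : 2 ≤ c) :
    ∃ q ∈ Set.Ioo 0 1, HasSum (localizationTerm (c * q) q) 1 := by
  have hc0 : 0 < c := by linarith
  have ha : c * (1 / (2 * c)) = 1 / 2 := by field_simp
  have hb : c * (3 / (5 * c)) = 3 / 5 := by field_simp
  have hab : 1 / (2 * c) ≤ 3 / (5 * c) := by
    rw [div_le_div_iff₀ (by positivity) (by positivity)]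
    linarith
  have hb1 : 3 / (5 * c) ≤ 3 / 10 := by
    rw [div_le_div_iff₀ (by positivity) (by norm_num)]
    linarith
  have ha0 : 0 < 1 / (2 * c) := by positivity
  set a := 1 / (2 * c)
  set b := 3 / (5 * c)
  have hle : localizationSum (c * a) a ≤ 1 := by
    refine localizationSum_le_one (by norm_num [ha]) ⟨ha0.le, by linarith⟩ ?_
    rw [ha]
    linarith
  have hge : 1 ≤ localizationSum (c * b) b := by
    refine one_le_localizationSum (by norm_num [hb]) ⟨by linarith, by linarith⟩ ?_
    have : 3 / 5 * b / (1 - 3 / 5 * b) ≤ 1 / 3 := by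
      rw [div_le_div_iff₀ (by linarith) (by norm_num)]
      linarith
    rw [hb]
    linarith
  obtain ⟨q, hq, hsum⟩ := intermediate_value_Icc hab
    ((continuousOn_localizationSum_mul_self hc0.le ⟨by linarith, by linarith⟩
      (by norm_num [hb])).mono (Set.Icc_subset_Icc_left ha0.le)) ⟨hle, hge⟩
  have hq0 : 0 < q := ha0.trans_le hq.1
  have hq1 : q < 1 := by linarith [hq.2]
  have hcq : c * q < 1 := by nlinarith [hq.2]
  refine ⟨q, ⟨hq0, hq1⟩, ?_⟩
  exact hsum ▸ (summable_localizationTerm ⟨by positivity, hcq⟩ ⟨hq0.le, hq1.le⟩).hasSum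

end Localization

section CriticalParameter

lemma geometricMeasure_symm_real_Iio {p : unitInterval} (hp : (p : ℝ) < 1) (n : ℕ) :
    (geometricMeasure (unitInterval.symm p)).real (Set.Iio n) = 1 - (p : ℝ) ^ n := by
  have hp' : unitInterval.symm p ≠ 0 := by
    rw [Ne, unitInterval.symm_eq_zero]
    exact fun h => hp.ne (congrArg Subtype.val h)
  rw [← Finset.coe_Iio, ← sum_measureReal_singleton, Nat.Iio_eq_range]
  simp only [geometricMeasure_real_singleton hp', unitInterval.coe_symm_eq, sub_sub_cancel]
  rw [← Finset.sum_mul, geom_sum_mul_neg]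

lemma geometricMeasure_symm_real_Ici {p : unitInterval} (hp : (p : ℝ) < 1) (n : ℕ) :
    (geometricMeasure (unitInterval.symm p)).real (Set.Ici n) = (p : ℝ) ^ n := by
  rw [← Set.compl_Iio, probReal_compl_eq_one_sub measurableSet_Iio,
    geometricMeasure_symm_real_Iio hp, sub_sub_cancel]

lemma reachWeight_geometricMeasure_mul_pow {p : unitInterval} (hp : (p : ℝ) < 1) (c : ℝ) (j : ℕ) :
    reachWeight (geometricMeasure (unitInterval.symm p)) j * c ^ (j + 1) =
      localizationTerm (c * p) p j := by
  simp only [reachWeight, geometricMeasure_symm_real_Ici hp, geometricMeasure_symm_real_Iio hp,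
    localizationTerm, mul_pow]
  ring

variable {d : ℕ} {q : ℝ}

lemma percolationProb_eq_zero_of_localizationSum_lt_one (hd : 0 < d) {p : unitInterval}
    (hp : (p : ℝ) < 1) (hdp : d * (p : ℝ) < 1) (h : localizationSum (d * p) p < 1) :
    percolationProb d p = 0 := by
  refine measureReal_percolates_eq_zero_of_tsum_lt_one _ hd ?_ ?_ <;>
    simp only [reachWeight_geometricMeasure_mul_pow hp]
  · exact summable_localizationTerm ⟨mul_nonneg d.cast_nonneg p.2.1, hdp⟩ p.2
  · exact h

lemma percolationProb_pos_of_one_lt_sum {p : unitInterval} (hp : (p : ℝ) < 1) {K : ℕ}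
    (h : 1 < ∑ j ∈ Finset.range K, localizationTerm (d * p) p j) : 0 < percolationProb d p := by
  refine measureReal_percolates_pos_of_one_lt_sum _ (K := K) ?_
  simpa only [reachWeight_geometricMeasure_mul_pow hp] using h

lemma mul_lt_one_of_hasSum_localizationTerm (hd : 0 < d) (hq : q ∈ Set.Ioo 0 1)
    (h : HasSum (localizationTerm (d * q) q) 1) : d * q < 1 :=
  lt_one_of_hasSum_localizationTerm (mul_pos (Nat.cast_pos.2 hd) hq.1)
    (Set.Ioo_subset_Ico_self hq) h

lemma lt_half_of_mul_lt_one (hd : 2 ≤ d) (h : d * q < 1) : q < 1 / 2 := by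
  have : (2 : ℝ) ≤ d := Nat.ofNat_le_cast.2 hd
  nlinarith

lemma percolationProb_eq_zero_of_lt (hd : 2 ≤ d) (hq : q ∈ Set.Ioo 0 1)
    (h : HasSum (localizationTerm (d * q) q) 1) {p : unitInterval} (hpq : (p : ℝ) < q) :
    percolationProb d p = 0 := by
  have hdq := mul_lt_one_of_hasSum_localizationTerm (by omega) hq h
  have hle : q * localizationSum (d * p) p ≤ p * localizationSum (d * q) q :=
    mul_localizationSum_le d.cast_nonneg p.2.1 hpq.le (lt_half_of_mul_lt_one hd hdq).le hdq
  rw [localizationSum.eq_def (d * q), h.tsum_eq, mul_one] at hle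
  refine percolationProb_eq_zero_of_localizationSum_lt_one (by omega) (hpq.trans hq.2)
    (hdq.trans_le' (by gcongr)) ?_
  exact lt_of_mul_lt_mul_left (by linarith) hq.1.le

lemma percolationProb_pos_of_lt (hq : 0 < q) (h : HasSum (localizationTerm (d * q) q) 1)
    {p : unitInterval} (hqp : q < p) (hp : (p : ℝ) ≤ 1 / 2) : 0 < percolationProb d p := by
  have hp0 : (0 : ℝ) < p := hq.trans hqp
  obtain ⟨K, hK⟩ := (h.tendsto_sum_nat.eventually_const_lt ((div_lt_one hp0).2 hqp)).exists
  have hle := Finset.sum_le_sum fun j (_ : j ∈ Finset.range K) =>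
    mul_localizationTerm_le d.cast_nonneg hq.le hqp.le hp j
  rw [← Finset.mul_sum, ← Finset.mul_sum] at hle
  rw [div_lt_iff₀' hp0] at hK
  refine percolationProb_pos_of_one_lt_sum (by linarith) (K := K) ?_
  exact lt_of_mul_lt_mul_left (by linarith) hq.le

theorem criticalParameter_eq_of_hasSum (hd : 2 ≤ d) (hq : q ∈ Set.Ioo 0 1)
    (h : HasSum (localizationTerm (d * q) q) 1) : criticalParameter d = q := by
  have hq2 : q < 1 / 2 :=
    lt_half_of_mul_lt_one hd (mul_lt_one_of_hasSum_localizationTerm (by omega) hq h)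
  refine csInf_eq_of_forall_ge_of_forall_gt_exists_lt ?_ ?_ fun w hw => ?_
  · exact ⟨1 / 2, by norm_num, percolationProb_pos_of_lt hq.1 h hq2 le_rfl⟩
  · rintro p ⟨_, hpos⟩
    by_contra! hlt
    exact hpos.ne' (percolationProb_eq_zero_of_lt hd hq h hlt)
  · obtain ⟨p, hqp, hp⟩ := exists_between (lt_min hw hq2)
    obtain ⟨hpw, hp2⟩ := lt_min_iff.1 hp
    exact ⟨p, ⟨⟨hq.1.trans hqp, by linarith⟩, percolationProb_pos_of_lt hq.1 h hqp hp2.le⟩, hpw⟩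

theorem criticalParameter_mem_Ioo_and_hasSum (hd : 2 ≤ d) :
    criticalParameter d ∈ Set.Ioo (0 : ℝ) 1 ∧
      HasSum (localizationTerm (d * criticalParameter d) (criticalParameter d)) 1 := by
  obtain ⟨q, hq, h⟩ := exists_hasSum_localizationTerm (c := d) (Nat.ofNat_le_cast.2 hd)
  rw [criticalParameter_eq_of_hasSum hd hq h]
  exact ⟨hq, h⟩

lemma le_criticalParameter (hd : 2 ≤ d) {a : ℝ} (ha : 0 < a) (hda : d * a < 1)
    (h : d * a * (2 - d * a * a) ≤ 1) : a ≤ criticalParameter d := by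
  obtain ⟨hq, hsum⟩ := criticalParameter_mem_Ioo_and_hasSum hd
  have ha2 := lt_half_of_mul_lt_one hd hda
  by_contra! hlt
  have hle := mul_localizationSum_le d.cast_nonneg hq.1.le hlt.le ha2.le hda
  have hsum_le : localizationSum (d * a) a ≤ 1 :=
    localizationSum_le_one ⟨by positivity, hda⟩ ⟨ha.le, by linarith⟩ h
  rw [localizationSum.eq_def (d * criticalParameter d), hsum.tsum_eq, mul_one] at hle
  linarith [mul_le_of_le_one_right hq.1.le hsum_le]

lemma criticalParameter_le (hd : 2 ≤ d) {b : ℝ} (hb : 0 < b) (hdb : d * b < 1)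
    (h : 1 ≤ d * b * (2 - d * b * b / (1 - d * b * b))) : criticalParameter d ≤ b := by
  obtain ⟨hq, hsum⟩ := criticalParameter_mem_Ioo_and_hasSum hd
  have hb2 := lt_half_of_mul_lt_one hd hdb
  have hdq := mul_lt_one_of_hasSum_localizationTerm (by omega) hq hsum
  by_contra! hlt
  have hle := mul_localizationSum_le d.cast_nonneg hb.le hlt.le
    (lt_half_of_mul_lt_one hd hdq).le hdq
  have hle_sum : 1 ≤ localizationSum (d * b) b :=
    one_le_localizationSum ⟨by positivity, hdb⟩ ⟨hb.le, by linarith⟩ h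
  rw [localizationSum.eq_def (d * criticalParameter d), hsum.tsum_eq, mul_one] at hle
  linarith [le_mul_of_one_le_right hq.1.le hle_sum]

end CriticalParameter

section ExplicitBounds

lemma criticalParameter_two_mem_Icc : criticalParameter 2 ∈ Set.Icc (0.266667 : ℝ) 0.277206 :=
  ⟨le_criticalParameter le_rfl (by norm_num) (by norm_num) (by norm_num),
    criticalParameter_le le_rfl (by norm_num) (by norm_num) (by norm_num)⟩

/-- As `q → 0`, the equation `y * (2 - y * q) = 1` has the solution `y = 1 / 2 + q / 8 + O(q ^ 2)`,
and `y = d * q` with `y = 1 / 2 + q / 8` is `q = 1 / (2 * d - 1 / 4)`. -/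
lemma one_div_le_criticalParameter {d : ℕ} (hd : 2 ≤ d) :
    1 / (2 * (d : ℝ) - 1 / 4) ≤ criticalParameter d := by
  have hd2 : (2 : ℝ) ≤ d := Nat.ofNat_le_cast.2 hd
  have hden : 0 < 2 * (d : ℝ) - 1 / 4 := by linarith
  have hmul : 1 / (2 * (d : ℝ) - 1 / 4) * (2 * d - 1 / 4) = 1 := one_div_mul_cancel hden.ne'
  have ha : 0 < 1 / (2 * (d : ℝ) - 1 / 4) := by positivity
  have ha1 : 1 / (2 * (d : ℝ) - 1 / 4) ≤ 1 := by
    rw [div_le_one hden]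
    linarith
  set a := 1 / (2 * (d : ℝ) - 1 / 4)
  have hda : d * a = 1 / 2 + a / 8 := by linarith
  refine le_criticalParameter hd ha (by linarith) ?_
  have hpos : 0 < a ^ 2 / 8 + a ^ 3 / 64 := by positivity
  rw [hda]
  linear_combination hpos

lemma mul_one_sub_sqrt_isRoot {B e b : ℝ} (hB : 0 < B) (he : e ≤ B ^ 2)
    (hb : b = B * (1 - √(1 - e / B ^ 2)) / 2) : b ^ 2 + e / 4 = B * b := by
  have hfrac : e / B ^ 2 ≤ 1 := div_le_one_of_le₀ he (sq_nonneg B)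
  have hsq : √(1 - e / B ^ 2) ^ 2 = 1 - e / B ^ 2 := Real.sq_sqrt (sub_nonneg.2 hfrac)
  have hmul : e / B ^ 2 * B ^ 2 = e := div_mul_cancel₀ _ (by positivity)
  rw [hb]
  linear_combination B ^ 2 / 4 * hsq - 1 / 4 * hmul

lemma mul_one_sub_sqrt_mem_Ioc {B e : ℝ} (hB : 0 < B) (he : 0 < e) :
    B * (1 - √(1 - e / B ^ 2)) / 2 ∈ Set.Ioc 0 (e / (2 * B)) := by
  have hfrac0 : 0 < e / B ^ 2 := by positivity
  have hlt : √(1 - e / B ^ 2) < 1 := (Real.sqrt_lt' one_pos).2 (by linarith)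
  have hge : 1 - e / B ^ 2 ≤ √(1 - e / B ^ 2) := Real.le_sqrt_self_iff.2 (by linarith)
  refine ⟨div_pos (mul_pos hB (sub_pos.2 hlt)) two_pos, ?_⟩
  calc B * (1 - √(1 - e / B ^ 2)) / 2
      ≤ B * (e / B ^ 2) / 2 := by gcongr; linarith
    _ = e / (2 * B) := by field_simp

lemma one_le_mul_two_sub_div {b y : ℝ} (hb : b ∈ Set.Ioc 0 (1 / 5))
    (hy : y = 1 / 2 + b / 7 + b ^ 2 / 7) : 1 ≤ y * (2 - y * b / (1 - y * b)) := by
  obtain ⟨hb0, hb5⟩ := hb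
  have hb2 : b ^ 2 ≤ 1 / 25 := by nlinarith
  have hyb : y * b < 1 := by nlinarith
  have hquad : 2 / 7 + 3 * (1 + b) ^ 2 / 49 ≤ 1 / 2 := by nlinarith
  have hslack : 0 ≤ b * (1 / 28 - b ^ 2 * (2 / 7 + 3 * (1 + b) ^ 2 / 49)) := by
    refine mul_nonneg hb0.le (sub_nonneg.2 ?_)
    calc b ^ 2 * (2 / 7 + 3 * (1 + b) ^ 2 / 49) ≤ 1 / 25 * (1 / 2) := by gcongr
      _ ≤ 1 / 28 := by norm_num
  have hkey : y * (y * b) ≤ (2 * y - 1) * (1 - y * b) := by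
    rw [hy]
    linear_combination hslack
  rw [mul_sub, ← mul_div_assoc, le_sub_comm, div_le_iff₀ (sub_pos.2 hyb)]
  linear_combination hkey

/-- The bound solves `d * q = 1 / 2 + q / 7 + q ^ 2 / 7`, where `1 / 7` leaves room over the exact
first-order coefficient `1 / 8`. -/
lemma criticalParameter_le_mul_one_sub_sqrt {d : ℕ} (hd : 3 ≤ d) :
    criticalParameter d ≤
      (7 * (d : ℝ) - 1) * (1 - √(1 - 14 / (7 * (d : ℝ) - 1) ^ 2)) / 2 := by
  have hd3 : (3 : ℝ) ≤ d := Nat.ofNat_le_cast.2 hd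
  have hB : 20 ≤ 7 * (d : ℝ) - 1 := by linarith
  have hB0 : 0 < 7 * (d : ℝ) - 1 := by linarith
  have he : 14 ≤ (7 * (d : ℝ) - 1) ^ 2 := by nlinarith
  obtain ⟨hb0, hb⟩ := mul_one_sub_sqrt_mem_Ioc (e := 14) hB0 (by norm_num)
  have hroot := mul_one_sub_sqrt_isRoot hB0 he rfl
  set b := (7 * (d : ℝ) - 1) * (1 - √(1 - 14 / (7 * (d : ℝ) - 1) ^ 2)) / 2
  have hdb : d * b = 1 / 2 + b / 7 + b ^ 2 / 7 := by linarith
  have hb_le : b ≤ 7 / 20 := hb.trans <| by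
    rw [div_le_div_iff₀ (by positivity) (by norm_num)]
    linarith
  have hb5 : b ≤ 1 / 5 := by nlinarith
  exact criticalParameter_le (by omega) hb0 (by nlinarith)
    (one_le_mul_two_sub_div ⟨hb0, hb5⟩ hdb)

end ExplicitBounds

end ConePercolation

theorem proposition1 :
    (∀ d : ℕ, 2 ≤ d →
      ConePercolation.criticalParameter d ∈ Set.Ioo (0 : ℝ) 1 ∧
      ConePercolation.SolvesLocalization 1 d (ConePercolation.criticalParameter d) ∧
      ∀ q ∈ Set.Ioo (0 : ℝ) 1, ConePercolation.SolvesLocalization 1 d q →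
        q = ConePercolation.criticalParameter d) ∧
    ((0.266667 : ℝ) ≤ ConePercolation.criticalParameter 2 ∧
      ConePercolation.criticalParameter 2 ≤ (0.277206 : ℝ)) ∧
    (∀ d : ℕ, 3 ≤ d →
      1 / (2 * (d : ℝ) - 1 / 4) ≤ ConePercolation.criticalParameter d ∧
      ConePercolation.criticalParameter d ≤
        (7 * (d : ℝ) - 1) * (1 - Real.sqrt (1 - 14 / (7 * (d : ℝ) - 1) ^ 2)) / 2) := by
  refine ⟨fun d hd => ?_, ConePercolation.criticalParameter_two_mem_Icc, fun d hd =>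
    ⟨ConePercolation.one_div_le_criticalParameter (by omega),
      ConePercolation.criticalParameter_le_mul_one_sub_sqrt hd⟩⟩
  obtain ⟨hmem, hsum⟩ := ConePercolation.criticalParameter_mem_Ioo_and_hasSum hd
  exact ⟨hmem, ConePercolation.solvesLocalization_one_iff.2 hsum, fun q hq hsol =>
    (ConePercolation.criticalParameter_eq_of_hasSum hd hq
      (ConePercolation.solvesLocalization_one_iff.1 hsol)).symm⟩
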